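/- **Setting.** Let $G$ be a directed acyclic graph on $[d]=\{1,\dots,d\}$, with parents $\mathrm{pa}(i)$, ancestors $\mathrm{anc}(i)$, and closures $\overline{\mathrm{pa}}(i)=\mathrm{pa}(i)\cup\{i\}$, $\overline{\mathrm{anc}}(i)=\mathrm{anc}(i)\cup\{i\}$. Let $\tau_1,\dots,\tau_K\subseteq[d]$ be known intervention targets. A latent causal Bayesian network (CBN) with graph $G$ and targets $(\tau_k)$ consists of a $C^1$-diffeomorphism $f:\mathbb R^d\to\mathbb R^d$, of conditional densities (causal mechanisms) $p_j(z_j\mid z_{\mathrm{pa}(j)})$, $j\in[d]$, and, for $k\in[K]$ and $j\in\tau_k$, of sets $\mathrm{pa}^k(j)\subseteq\mathrm{pa}(j)$ and conditional densities (intervened mechanisms) $\tilde p^k_j(z_j\mid z_{\mathrm{pa}^k(j)})$. Its latent distributions $\mathbb P^0,\dots,\mathbb P^K$ have the densities $p^0=\prod_j p_j$ and $p^k=\prod_{j\in\tau_k}\tilde p^k_j\prod_{j\notin\tau_k}p_j$, which are assumed to be everywhere positive and differentiable on $\mathbb R^d$. Regime $k$ with $\tau_k=\{j\}$ satisfies *interventional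 discrepancy* if, for almost every $z$, the derivatives $\partial_{z_j}\ln p_j(z_j\mid z_{\mathrm{pa}(j)})$ and $\partial_{z_j}\ln\tilde p^k_j(z_j\mid z_{\mathrm{pa}^k(j)})$ exist and are different. The intervention on $j$ in regime $k$ is *structure-preserving* if $\mathrm{pa}^k(j)=\mathrm{pa}(j)$. Fix $i\in[d]$ and let $n_i=|\overline{\mathrm{pa}}(i)|$. Distinct regimes $k_1,\dots,k_{n_i(n_i+1)}$ with $\tau_{k_t}=\{i\}$ that are structure-preserving satisfy the *variability condition* $V^i$ if, with $$\delta_r^t=\frac{\partial_{z_r}\tilde p_i^{k_t}}{\tilde p_i^{k_t}}-\frac{\partial_{z_r}p_i}{p_i}\qquad(r\in\overline{\mathrm{pa}}(i)),$$ all the partial derivatives $\partial_{z_r}\tilde p_i^{k_t}$, $\partial_{z_r}p_i$ and $\partial_{z_m}\delta^t_r$ ($r,m\in\overline{\mathrm{pa}}(i)$) exist everywhere and, at every point $x\in\mathbb R^d$, the $n_i(n_i+1)\times n_i(n_i+1)$ matrix whose $t$-th row is $$\Big(\big(\partial_{z_m}\delta_r^t(x)\big)_{r,m\in\overline{\mathrm{pa}}(i)},\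 \big(\delta_r^t(x)\big)_{r\in\overline{\mathrm{pa}}(i)}\Big)$$ has no nonzero vector $(a,b)$ in its kernel with $a\in\mathbb R^{n_i\times n_i}$ symmetric and $b\in\mathbb R^{n_i}$. (This holds in particular if the matrix is invertible. For twice differentiable mechanisms the columns $(r,m)$ and $(m,r)$ coincide, and the condition says that the columns are linearly independent once one column of each such pair with $r\ne m$ is deleted.) **Proposition.** Suppose that $\mathrm{pa}(i)\neq\emptyset$ and $\mathrm{pa}(i)\neq\mathrm{anc}(i)$. Let $(f,(\mathbb P^k))$ and $(f',(\mathbb Q^k))$ be two latent CBNs with graph $G$ and targets $(\tau_k)$ such that * at least one of the two has, for every node $j\in[d]$, a regime $k$ with $\tau_k=\{j\}$ that satisfies interventional discrepancy, and * at least one of the two has $n_i(n_i+1)$ structure-preserving interventions on $i$ that satisfy $V^i$. If $f_*\mathbb P^k=f'_*\mathbb Q^k$ for all $k\in\{0,\dots,K\}$, then $h:=f'^{-1}\circ f$ is a $C^1$-diffeomorphism of $\mathbb R^d$ such that, for every $j\in[d]$, $h_j(z)$ depends only on $z_{\overline{\mathrm{anc}}(j)}$ and, for every $j\in\overline{\mathrm{pa}}(i)$,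 $h_j(z)$ depends only on $z_{\overline{\mathrm{pa}}(i)}$. That is, causal component analysis is identifiable up to $$\mathcal S_{\overline G_i}=\Big\{h\ C^1\text{-diffeomorphism of }\mathbb R^d:\ h(z)=\big(h_j(z_{\overline{\mathrm{anc}}(j)})\big)_{j\in[d]},\ h_j=h_j(z_{\overline{\mathrm{pa}}(i)})\ \forall j\in\overline{\mathrm{pa}}(i)\Big\}.$$ -/

import Mathlib

open MeasureTheory

/-- A directed acyclic graph on the nodes `Fin d`; `G.Adj j i` means that there is an arrow
from `j` to `i`. -/
structure CausalDAG (d : ℕ) extends Digraph (Fin d) where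
  acyclic : ∀ i, ¬ Relation.TransGen Adj i i

namespace CausalDAG

variable {d : ℕ} (G : CausalDAG d)

open Classical in
/-- The parents `pa(i)`. -/
noncomputable def parents (i : Fin d) : Finset (Fin d) :=
  Finset.univ.filter fun j => G.Adj j i

open Classical in
/-- The ancestors `anc(i)`: the nodes from which a directed path leads to `i`. -/
noncomputable def ancestors (i : Fin d) : Finset (Fin d) :=
  Finset.univ.filter fun j => Relation.TransGen G.Adj j i

/-- The closure `pa(i) ∪ {i}` of the parents. -/
noncomputable def closedParents (i : Fin d) : Finset (Fin d) := insert i (G.parents i)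

/-- The closure `anc(i) ∪ {i}` of the ancestors. -/
noncomputable def closedAncestors (i : Fin d) : Finset (Fin d) := insert i (G.ancestors i)

end CausalDAG

/-- The `C¹`-diffeomorphisms of `ℝ^d`. -/
abbrev C1Diffeo (d : ℕ) : Type :=
  Diffeomorph (modelWithCornersSelf ℝ (Fin d → ℝ)) (modelWithCornersSelf ℝ (Fin d → ℝ))
    (Fin d → ℝ) (Fin d → ℝ) 1

/-- `F` is a conditional probability density of the `j`-th coordinate given the coordinates in
`S`. It is written as a function on `ℝ^d` that depends only on the coordinates in `{j} ∪ S`.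
(An integral with value `1` forces integrability.) -/
structure IsCondDensity {d : ℕ} (j : Fin d) (S : Finset (Fin d)) (F : (Fin d → ℝ) → ℝ) :
    Prop where
  dependsOn : DependsOn F (↑(insert j S) : Set (Fin d))
  measurable : Measurable F
  nonneg : ∀ z, 0 ≤ F z
  integral_eq_one : ∀ z, ∫ x : ℝ, F (Function.update z j x) = 1

/-- A causal Bayesian network with graph `G` and `K` interventional regimes with targets `τ`,
given by the densities of its mechanisms: `mech j` is the causal mechanism of node `j`,
`imech k j` is, for a target `j ∈ τ k`, the intervened mechanism of node `j` in regime `k`, and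
`ipa k j ⊆ pa(j)` is the set of parents of `j` after the intervention. -/
structure CBN {d K : ℕ} (G : CausalDAG d) (τ : Fin K → Finset (Fin d)) where
  mech : Fin d → (Fin d → ℝ) → ℝ
  ipa : Fin K → Fin d → Finset (Fin d)
  imech : Fin K → Fin d → (Fin d → ℝ) → ℝ
  ipa_subset : ∀ k, ∀ j ∈ τ k, ipa k j ⊆ G.parents j
  mech_cond : ∀ j, IsCondDensity j (G.parents j) (mech j)
  imech_cond : ∀ k, ∀ j ∈ τ k, IsCondDensity j (ipa k j) (imech k j)

/-- The partial derivative in the `r`-th coordinate. -/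
noncomputable def pderivAt {d : ℕ} (r : Fin d) (F : (Fin d → ℝ) → ℝ) (z : Fin d → ℝ) : ℝ :=
  deriv (fun x : ℝ => F (Function.update z r x)) (z r)

/-- The partial derivative in the `r`-th coordinate exists everywhere. -/
def HasPartial {d : ℕ} (r : Fin d) (F : (Fin d → ℝ) → ℝ) : Prop :=
  ∀ z, DifferentiableAt ℝ (fun x : ℝ => F (Function.update z r x)) (z r)

namespace CBN

variable {d K : ℕ} {G : CausalDAG d} {τ : Fin K → Finset (Fin d)} (M : CBN G τ)

/-- The joint density in a regime: `none` is the unintervened regime, `some k` is the `k`-th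
interventional regime. -/
noncomputable def density : Option (Fin K) → (Fin d → ℝ) → ℝ
  | none => fun z => ∏ j, M.mech j z
  | some k => fun z => ∏ j, if j ∈ τ k then M.imech k j z else M.mech j z

/-- The joint distribution `ℙᵏ` of the latent variables in a regime. -/
noncomputable def law (k : Option (Fin K)) : Measure (Fin d → ℝ) :=
  volume.withDensity fun z => ENNReal.ofReal (M.density k z)

/-- Interventional discrepancy of regime `k` at the node `j`: almost everywhere, the partial
derivatives in `z_j` of the log densities of the causal and of the intervened mechanism of `j`
exist and are different. -/
def Discrepancy (k : Fin K) (j : Fin d) : Prop :=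
  ∀ᵐ z : Fin d → ℝ, ∃ a b : ℝ,
    HasDerivAt (fun x : ℝ => Real.log (M.mech j (Function.update z j x))) a (z j) ∧
    HasDerivAt (fun x : ℝ => Real.log (M.imech k j (Function.update z j x))) b (z j) ∧
    a ≠ b

/-- Every node has a single-node intervention that satisfies interventional discrepancy. -/
def DiscrepancyAtEveryNode : Prop :=
  ∀ j : Fin d, ∃ k : Fin K, τ k = {j} ∧ M.Discrepancy k j

/-- `g_i^{r,k} - h_i^r`, where `g_i^{r,k} = (∂q̃/∂z_r) / q̃` for the intervened mechanism `q̃` of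
node `i` in regime `k` and `h_i^r = (∂q/∂z_r) / q` for its causal mechanism `q`. -/
noncomputable def scoreDiff (i : Fin d) (k : Fin K) (r : Fin d) (z : Fin d → ℝ) : ℝ :=
  pderivAt r (M.imech k i) z / M.imech k i z - pderivAt r (M.mech i) z / M.mech i z

/-- The matrix whose row `t` is `(A_i^t, B_i^t)` at the latent point `x`, for the regimes `σ t`:
the entry of `A_i^t` at `(r, m)` is `∂(g_i^{r,t} - h_i^r)/∂x_m`, the entry of `B_i^t` at `r` is
`g_i^{r,t} - h_i^r`, and `r`, `m` run through the closure of `pa(i)`. -/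
noncomputable def variabilityMatrix (i : Fin d) {N : ℕ} (σ : Fin N → Fin K) (x : Fin d → ℝ) :
    Matrix (Fin N) ((G.closedParents i × G.closedParents i) ⊕ G.closedParents i) ℝ :=
  Matrix.of fun t => Sum.elim
    (fun rm => pderivAt rm.2.1 (M.scoreDiff i (σ t) rm.1.1) x)
    (fun r => M.scoreDiff i (σ t) r.1 x)

/-- Nondegeneracy of the variability matrix at `x`: it kills no nonzero vector `(a, b)` with
`a` a symmetric matrix. Because of `∂_m (g^r - h^r) = ∂_r (g^m - h^m)` for twice differentiable
mechanisms, the columns `(r, m)` and `(m, r)` are equal then, every `(a, 0)` with `a`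
skew-symmetric is killed, and nondegeneracy says that the columns that remain when one of each
such pair is deleted are linearly independent. -/
def NondegenerateAt (i : Fin d) {N : ℕ} (σ : Fin N → Fin K) (x : Fin d → ℝ) : Prop :=
  ∀ (a : Matrix (G.closedParents i) (G.closedParents i) ℝ) (b : G.closedParents i → ℝ),
    a.IsSymm →
    (M.variabilityMatrix i σ x).mulVec (Sum.elim (fun rm => a rm.1 rm.2) b) = 0 →
    a = 0 ∧ b = 0

/-- Invertibility of the whole variability matrix is a stronger condition. -/
theorem NondegenerateAt.of_bijective {i : Fin d} {N : ℕ} {σ : Fin N → Fin K} {x : Fin d → ℝ}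
    (h : Function.Bijective (M.variabilityMatrix i σ x).mulVec) : M.NondegenerateAt i σ x := by
  intro a b _ hab
  have h0 : Sum.elim (fun rm : G.closedParents i × G.closedParents i => a rm.1 rm.2) b = 0 :=
    h.1 (by rw [hab, Matrix.mulVec_zero])
  refine ⟨?_, ?_⟩
  · ext r m
    exact congrFun h0 (Sum.inl (r, m))
  · funext r
    exact congrFun h0 (Sum.inr r)

/-- There are `n (n + 1)` structure-preserving single-node interventions on `i`, where `n` is the
number of elements of the closure of `pa(i)`, for which the variability condition holds: the
derivatives that enter the variability matrix exist and the matrix is nondegenerate at every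
latent point. -/
def Variability (i : Fin d) : Prop :=
  ∃ σ : Fin ((G.closedParents i).card * ((G.closedParents i).card + 1)) ↪ Fin K,
    (∀ t, τ (σ t) = {i} ∧ M.ipa (σ t) i = G.parents i) ∧
    (∀ r ∈ G.closedParents i, HasPartial r (M.mech i)) ∧
    (∀ t, ∀ r ∈ G.closedParents i, HasPartial r (M.imech (σ t) i)) ∧
    (∀ t, ∀ r ∈ G.closedParents i, ∀ m ∈ G.closedParents i,
      HasPartial m (M.scoreDiff i (σ t) r)) ∧
    ∀ x, M.NondegenerateAt i σ x

end CBN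

/-- A latent causal Bayesian network with a `C¹`-diffeomorphism as mixing function and joint
densities that are everywhere positive and differentiable in all regimes. -/
structure LatentCBN {d K : ℕ} (G : CausalDAG d) (τ : Fin K → Finset (Fin d))
    extends CBN G τ where
  mix : C1Diffeo d
  density_pos : ∀ k z, 0 < toCBN.density k z
  density_differentiable : ∀ k, Differentiable ℝ (toCBN.density k)

/-- Identifiability up to the indeterminacy set `S`: whenever two latent CBNs with the same graph
and the same intervention targets, subject to `Adm`, have the same observed distributions in all
regimes, the map `f'⁻¹ ∘ f` belongs to `S`. (Identifiability in a model class `C` is the case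
that `Adm M M'` says that both models are in `C`. All latent distributions have full support, so
that `h = f'⁻¹ ∘ f` on the support is equality everywhere.) -/
def IdentifiableUpTo {d K : ℕ} {G : CausalDAG d} {τ : Fin K → Finset (Fin d)}
    (Adm : LatentCBN G τ → LatentCBN G τ → Prop) (S : Set ((Fin d → ℝ) → (Fin d → ℝ))) : Prop :=
  ∀ M M' : LatentCBN G τ, Adm M M' →
    (∀ k, (M.law k).map M.mix = (M'.law k).map M'.mix) →
    ∃ h ∈ S, ∀ z, h z = M'.mix.symm (M.mix z)

/-- The indeterminacy set of node `i`: the `C¹`-diffeomorphisms `h` of `ℝ^d` such that every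
`h_j` depends only on the closed ancestors of `j`, and, for `j` in the closure of `pa(i)`, only
on the closure of `pa(i)`. -/
def parentIndeterminacy {d : ℕ} (G : CausalDAG d) (i : Fin d) :
    Set ((Fin d → ℝ) → (Fin d → ℝ)) :=
  {h | (∃ e : C1Diffeo d, ⇑e = h) ∧
    (∀ j, DependsOn (fun z => h z j) (↑(G.closedAncestors j) : Set (Fin d))) ∧
    ∀ j ∈ G.closedParents i, DependsOn (fun z => h z j) (↑(G.closedParents i) : Set (Fin d))}

/-! In a regime that intervenes on `j` alone, all other mechanisms cancel from the log ratio `R` of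
the intervened to the unintervened density, so `R` depends only on the closed parents of `j`. The
Jacobian of the transition map `h` does not depend on the regime, so it cancels too: `R = R' ∘ h`
(`logRatio_eq_of_map_eq`). By the chain rule, if `v` vanishes on the closed parents of `j`, then the
differential of `R'` at `h z` kills `w = Dh(z) v`.

Two choices of regimes turn this into vanishing of coordinates of `w`. Discrepancy, with induction
along the graph, gives the ancestor statement almost everywhere, hence everywhere by continuity of
`Dh` (`preserves_closedAncestors`). For the parents of `i`, the gradients of the `R'` are the
first-order columns of the variability matrix, whose independence forces `w` to vanish on the closed
parents (`preserves_closedParents`); the second-order columns play no role.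

Each assumption may concern either model, because block triangularity passes to the inverse
(`C1Diffeo.Preserves.symm`). -/

/-! ### Functions on `ℝ^d` that depend on a set of coordinates -/

section DependsOn

variable {d : ℕ} {F : (Fin d → ℝ) → ℝ} {S : Set (Fin d)}

/-- Two points that agree on `S` are joined by a segment whose direction vanishes on `S`, and `F`
has zero derivative along it. -/
theorem DependsOn.of_fderiv_eq_zero (hF : Differentiable ℝ F)
    (h : ∀ z v, (∀ r ∈ S, v r = 0) → fderiv ℝ F z v = 0) : DependsOn F S := by
  intro x y hxy
  have hg : ∀ t : ℝ, HasDerivAt (fun t : ℝ => F (x + t • (y - x))) 0 t := by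
    intro t
    have h1 : HasDerivAt (fun t : ℝ => x + t • (y - x)) (y - x) t := by
      simpa using ((hasDerivAt_id t).smul_const (y - x)).const_add x
    have h2 := (hF (x + t • (y - x))).hasFDerivAt.comp_hasDerivAt t h1
    rwa [h _ (y - x) fun r hr => by simp [hxy r hr]] at h2
  have := is_const_of_deriv_eq_zero (fun t => (hg t).differentiableAt)
    (fun t => (hg t).deriv) 0 1
  simpa using this

theorem DependsOn.fderiv_eq_zero (hF : Differentiable ℝ F) (hS : DependsOn F S)
    (z : Fin d → ℝ) {v : Fin d → ℝ} (hv : ∀ r ∈ S, v r = 0) : fderiv ℝ F z v = 0 := by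
  have h1 : HasDerivAt (fun t : ℝ => z + t • v) v 0 := by
    simpa using ((hasDerivAt_id (0 : ℝ)).smul_const v).const_add z
  have hz : HasFDerivAt F (fderiv ℝ F z) (z + (0 : ℝ) • v) := by
    simpa using (hF z).hasFDerivAt
  have h2 := hz.comp_hasDerivAt (0 : ℝ) h1
  have h3 : (F ∘ fun t : ℝ => z + t • v) = fun _ => F z := by
    funext t
    exact hS fun r hr => by simp [hv r hr]
  rw [h3] at h2
  exact h2.unique (hasDerivAt_const _ _)

theorem hasDerivAt_update_of_differentiable (hF : Differentiable ℝ F) (z : Fin d → ℝ)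
    (r : Fin d) :
    HasDerivAt (fun x : ℝ => F (Function.update z r x)) (fderiv ℝ F z (Pi.single r 1)) (z r) := by
  have h1 : HasDerivAt (fun x : ℝ => Function.update z r x) (Pi.single r 1) (z r) :=
    hasDerivAt_update z r (z r)
  have hz : HasFDerivAt F (fderiv ℝ F z) (Function.update z r (z r)) := by
    simpa using (hF z).hasFDerivAt
  exact hz.comp_hasDerivAt (z r) h1

end DependsOn

/-! ### Diffeomorphisms of `ℝ^d` -/

namespace C1Diffeo

variable {d : ℕ} (e : C1Diffeo d)

theorem contDiff_coe : ContDiff ℝ 1 e := e.contMDiff_toFun.contDiff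

theorem differentiable_coe : Differentiable ℝ e := e.contDiff_coe.differentiable one_ne_zero

theorem differentiable_coord (j : Fin d) : Differentiable ℝ fun z => e z j :=
  differentiable_pi.1 e.differentiable_coe j

theorem fderiv_coord (j : Fin d) (z v : Fin d → ℝ) :
    fderiv ℝ (fun z => e z j) z v = fderiv ℝ e z v j := by
  have := (hasFDerivAt_pi'.1 (e.differentiable_coe z).hasFDerivAt j).fderiv
  rw [this]
  rfl

theorem fderiv_symm_fderiv (z v : Fin d → ℝ) :
    fderiv ℝ e.symm (e z) (fderiv ℝ e z v) = v := by
  have h1 := (differentiable_coe e.symm (e z)).hasFDerivAt.comp z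
    (e.differentiable_coe z).hasFDerivAt
  have h2 : (e.symm ∘ e : (Fin d → ℝ) → (Fin d → ℝ)) = id := by
    funext x
    exact e.symm_apply_apply x
  rw [h2] at h1
  exact congrArg (fun L : (Fin d → ℝ) →L[ℝ] (Fin d → ℝ) => L v) (h1.unique (hasFDerivAt_id z))

/-- The preimage is an image under the differentiable inverse. This pulls almost-everywhere
conditions on the target model back along `h`. -/
theorem preimage_null {N : Set (Fin d → ℝ)} (hN : volume N = 0) : volume (e ⁻¹' N) = 0 := by
  have h : e ⁻¹' N = e.symm '' N := (e.symm.toEquiv.image_eq_preimage_symm N).symm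
  rw [h]
  exact addHaar_image_eq_zero_of_differentiableOn_of_addHaar_eq_zero volume
    (differentiable_coe e.symm).differentiableOn hN

/-- The coordinates of `e` in `S` depend only on the coordinates in `S`. -/
def Preserves (S : Set (Fin d)) : Prop := ∀ r ∈ S, DependsOn (fun z => e z r) S

variable {e}

/-- Reduces the property to linear algebra at each point: the derivative maps the subspace of
vectors vanishing on `S` into itself. -/
theorem preserves_iff_fderiv {S : Set (Fin d)} :
    e.Preserves S ↔ ∀ z v, (∀ r ∈ S, v r = 0) → ∀ r ∈ S, fderiv ℝ e z v r = 0 := by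
  constructor
  · intro h z v hv r hr
    rw [← fderiv_coord]
    exact (h r hr).fderiv_eq_zero (e.differentiable_coord r) z hv
  · intro h r hr
    refine DependsOn.of_fderiv_eq_zero (e.differentiable_coord r) fun z v hv => ?_
    rw [fderiv_coord]
    exact h z v hv r hr

/-- An injective endomorphism of a finite-dimensional space is surjective, so the derivative maps
the invariant subspace `W` onto itself and its inverse preserves `W` as well. -/
theorem Preserves.symm {S : Set (Fin d)} (h : e.Preserves S) : Preserves e.symm S := by
  rw [preserves_iff_fderiv] at h ⊢
  intro y w hw
  obtain ⟨z, rfl⟩ := e.surjective y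
  let W : Submodule ℝ (Fin d → ℝ) :=
    { carrier := {v | ∀ r ∈ S, v r = 0}
      add_mem' := fun {a b} ha hb r hr => by simp [ha r hr, hb r hr]
      zero_mem' := fun r _ => rfl
      smul_mem' := fun c a ha r hr => by simp [ha r hr] }
  let L : W →ₗ[ℝ] W := (fderiv ℝ e z).toLinearMap.restrict fun v hv => h z v hv
  have hL : Function.Injective L := by
    intro a b hab
    have h1 : fderiv ℝ e z a = fderiv ℝ e z b := congrArg Subtype.val hab
    have h2 := congrArg (fderiv ℝ e.symm (e z)) h1
    rw [fderiv_symm_fderiv, fderiv_symm_fderiv] at h2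
    exact Subtype.ext h2
  obtain ⟨v, hv⟩ := LinearMap.injective_iff_surjective.1 hL ⟨w, hw⟩
  have h1 : fderiv ℝ e z v = w := congrArg Subtype.val hv
  have h2 : fderiv ℝ e.symm (e z) w = v := by rw [← h1, fderiv_symm_fderiv]
  exact fun r hr => (congrFun h2 r).trans (v.2 r hr)

end C1Diffeo

/-! ### Closures of parents and ancestors -/

namespace CausalDAG

variable {d : ℕ} (G : CausalDAG d)

theorem mem_ancestors {i j : Fin d} : j ∈ G.ancestors i ↔ Relation.TransGen G.Adj j i := by
  simp [ancestors]

theorem mem_parents {i j : Fin d} : j ∈ G.parents i ↔ G.Adj j i := by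
  simp [parents]

theorem closedAncestors_subset {j m : Fin d} (h : m ∈ G.closedAncestors j) :
    G.closedAncestors m ⊆ G.closedAncestors j := by
  intro l hl
  simp only [closedAncestors, Finset.mem_insert, mem_ancestors] at *
  rcases hl with rfl | hl
  · exact h
  · rcases h with rfl | h
    · exact Or.inr hl
    · exact Or.inr (hl.trans h)

theorem parents_subset_closedAncestors (j : Fin d) : G.parents j ⊆ G.closedAncestors j := by
  intro l hl
  rw [mem_parents] at hl
  exact Finset.mem_insert_of_mem (G.mem_ancestors.2 (.single hl))

theorem closedParents_subset_closedAncestors (j : Fin d) :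
    G.closedParents j ⊆ G.closedAncestors j :=
  Finset.insert_subset (Finset.mem_insert_self _ _) (G.parents_subset_closedAncestors j)

theorem wellFounded_adj : WellFounded G.Adj := by
  have : IsTrans (Fin d) (Relation.TransGen G.Adj) := ⟨fun _ _ _ => Relation.TransGen.trans⟩
  have : Std.Irrefl (Relation.TransGen G.Adj) := ⟨G.acyclic⟩
  exact Subrelation.wf (fun h => Relation.TransGen.single h)
    (Finite.wellFounded_of_trans_of_irrefl (Relation.TransGen G.Adj))

end CausalDAG

/-! ### Log density ratios of single-node regimes -/

namespace LatentCBN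

variable {d K : ℕ} {G : CausalDAG d} {τ : Fin K → Finset (Fin d)} (M M' : LatentCBN G τ)

theorem mech_pos (j : Fin d) (z : Fin d → ℝ) : 0 < M.mech j z := by
  refine lt_of_le_of_ne ((M.mech_cond j).nonneg z) fun h => ?_
  have h1 := M.density_pos none z
  exact h1.ne' (Finset.prod_eq_zero (Finset.mem_univ j) h.symm)

theorem imech_pos {k : Fin K} {j : Fin d} (hj : j ∈ τ k) (z : Fin d → ℝ) :
    0 < M.imech k j z := by
  refine lt_of_le_of_ne ((M.imech_cond k j hj).nonneg z) fun h => ?_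
  have h1 := M.density_pos (some k) z
  exact h1.ne' (Finset.prod_eq_zero (Finset.mem_univ j) (by simp [hj, ← h]))

/-- The log ratio of the joint densities of regime `k` and of the unintervened regime. -/
noncomputable def logRatio (k : Fin K) (z : Fin d → ℝ) : ℝ :=
  Real.log (M.density (some k) z) - Real.log (M.density none z)

theorem differentiable_logRatio (k : Fin K) : Differentiable ℝ (M.logRatio k) :=
  ((M.density_differentiable (some k)).log fun z => (M.density_pos _ z).ne').sub
    ((M.density_differentiable none).log fun z => (M.density_pos _ z).ne')

variable {M M'}

theorem logRatio_eq {k : Fin K} {j : Fin d} (hk : τ k = {j}) (z : Fin d → ℝ) :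
    M.logRatio k z = Real.log (M.imech k j z) - Real.log (M.mech j z) := by
  have hj : j ∈ τ k := by simp [hk]
  have hm : ∀ m, M.mech m z ≠ 0 := fun m => (M.mech_pos m z).ne'
  have h1 : M.density (some k) z =
      M.imech k j z * ∏ m ∈ Finset.univ.erase j, M.mech m z := by
    simp only [CBN.density]
    rw [← Finset.mul_prod_erase _ _ (Finset.mem_univ j), if_pos hj]
    congr 1
    refine Finset.prod_congr rfl fun m hm => ?_
    rw [if_neg (by simpa [hk] using hm)]
  have h2 : M.density none z = M.mech j z * ∏ m ∈ Finset.univ.erase j, M.mech m z :=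
    (Finset.mul_prod_erase _ _ (Finset.mem_univ j)).symm
  have h3 : ∏ m ∈ Finset.univ.erase j, M.mech m z ≠ 0 :=
    Finset.prod_ne_zero_iff.2 fun m _ => hm m
  rw [logRatio, h1, h2, Real.log_mul (M.imech_pos hj z).ne' h3, Real.log_mul (hm j) h3]
  ring

theorem dependsOn_logRatio {k : Fin K} {j : Fin d} (hk : τ k = {j}) :
    DependsOn (M.logRatio k) (↑(G.closedParents j) : Set (Fin d)) := by
  have hj : j ∈ τ k := by simp [hk]
  intro x y hxy
  have h1 : M.imech k j x = M.imech k j y := (M.imech_cond k j hj).dependsOn fun r hr =>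
    hxy r (Finset.insert_subset_insert j (M.ipa_subset k j hj) hr)
  have h2 : M.mech j x = M.mech j y := (M.mech_cond j).dependsOn hxy
  rw [logRatio_eq hk, logRatio_eq hk, h1, h2]

theorem fderiv_logRatio_ne_zero {k : Fin K} {j : Fin d} (hk : τ k = {j})
    (hdis : M.Discrepancy k j) :
    ∀ᵐ z : Fin d → ℝ, fderiv ℝ (M.logRatio k) z (Pi.single j 1) ≠ 0 := by
  filter_upwards [hdis] with z ⟨a, b, ha, hb, hab⟩
  have h1 := hasDerivAt_update_of_differentiable (M.differentiable_logRatio k) z j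
  simp only [logRatio_eq hk] at h1
  rw [h1.unique (hb.sub ha)]
  exact sub_ne_zero.2 hab.symm

/-- Identifies the gradient of the log ratio with a row of the first-order block of the variability
matrix. -/
theorem fderiv_logRatio_eq_scoreDiff {k : Fin K} {i r : Fin d} (hk : τ k = {i})
    (h : HasPartial r (M.mech i)) (h' : HasPartial r (M.imech k i)) (z : Fin d → ℝ) :
    fderiv ℝ (M.logRatio k) z (Pi.single r 1) = M.scoreDiff i k r z := by
  have h1 := hasDerivAt_update_of_differentiable (M.differentiable_logRatio k) z r
  simp only [logRatio_eq hk] at h1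
  have h2 := (h z).hasDerivAt.log (by simpa using (M.mech_pos i z).ne')
  have h3 := (h' z).hasDerivAt.log (by simpa using (M.imech_pos (by simp [hk]) z).ne')
  rw [h1.unique (h3.sub h2)]
  simp [CBN.scoreDiff, pderivAt]

/-! ### Change of variables -/

/-- Equality of measures gives equality of densities only almost everywhere; both sides are
continuous, so it holds at every point. -/
theorem density_eq_of_map_eq {h : C1Diffeo d} {k : Option (Fin K)}
    (hlaw : (M.law k).map h = M'.law k) (z : Fin d → ℝ) :
    M.density k z = |(fderiv ℝ h z).det| * M'.density k (h z) := by
  have hc : Continuous (M.density k) := (M.density_differentiable k).continuous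
  have hc' : Continuous (M'.density k) := (M'.density_differentiable k).continuous
  have hdet : Continuous fun z => |(fderiv ℝ h z).det| :=
    (ContinuousLinearMap.continuous_det.comp
      (h.contDiff_coe.continuous_fderiv one_ne_zero)).abs
  have hcr : Continuous fun z => |(fderiv ℝ h z).det| * M'.density k (h z) :=
    hdet.mul (hc'.comp h.continuous)
  have hmeas : M.law k =
      volume.withDensity fun z => ENNReal.ofReal (|(fderiv ℝ h z).det| * M'.density k (h z)) := by
    ext s hs
    have hs' : MeasurableSet (h '' s) := h.toHomeomorph.measurableEmbedding.measurableSet_image' hs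
    have h1 : M.law k s = M'.law k (h '' s) := by
      rw [← hlaw, Measure.map_apply h.continuous.measurable hs',
        show h ⁻¹' (h '' s) = s from Set.preimage_image_eq s h.injective]
    rw [h1, CBN.law, withDensity_apply _ hs', withDensity_apply _ hs,
      lintegral_image_eq_lintegral_abs_det_fderiv_mul volume hs
        (fun x _ => (h.differentiable_coe x).hasFDerivAt.hasFDerivWithinAt) h.injective.injOn]
    simp_rw [ENNReal.ofReal_mul (abs_nonneg _)]
  have hae : (fun z => ENNReal.ofReal (M.density k z)) =ᵐ[volume]
      fun z => ENNReal.ofReal (|(fderiv ℝ h z).det| * M'.density k (h z)) :=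
    (withDensity_eq_iff_of_sigmaFinite (ENNReal.measurable_ofReal.comp hc.measurable).aemeasurable
      (ENNReal.measurable_ofReal.comp hcr.measurable).aemeasurable).1 hmeas
  have heq : (fun z => M.density k z) =ᵐ[volume]
      fun z => |(fderiv ℝ h z).det| * M'.density k (h z) := by
    filter_upwards [hae] with z hz
    exact (ENNReal.ofReal_eq_ofReal_iff (M.density_pos k z).le
      (mul_nonneg (abs_nonneg _) (M'.density_pos k _).le)).1 hz
  exact congrFun ((hc.ae_eq_iff_eq volume hcr).1 heq) z

theorem logRatio_eq_of_map_eq {h : C1Diffeo d}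
    (hlaw : ∀ k, (M.law k).map h = M'.law k) (k : Fin K) (z : Fin d → ℝ) :
    M.logRatio k z = M'.logRatio k (h z) := by
  have h0 := density_eq_of_map_eq (hlaw none) z
  -- A zero Jacobian would contradict positivity of the density.
  have hD : |(fderiv ℝ h z).det| ≠ 0 := by
    intro hD
    rw [hD, zero_mul] at h0
    exact (M.density_pos none z).ne' h0
  rw [logRatio, logRatio, h0, density_eq_of_map_eq (hlaw (some k)) z,
    Real.log_mul hD (M'.density_pos _ _).ne', Real.log_mul hD (M'.density_pos _ _).ne']
  ring

/-! ### Consequences for the derivative of the transition map -/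

theorem fderiv_logRatio_comp {h : C1Diffeo d}
    (hR : ∀ k z, M.logRatio k z = M'.logRatio k (h z)) (k : Fin K) (z v : Fin d → ℝ) :
    fderiv ℝ (M'.logRatio k) (h z) (fderiv ℝ h z v) = fderiv ℝ (M.logRatio k) z v := by
  have h1 := (M'.differentiable_logRatio k (h z)).hasFDerivAt.comp z
    (h.differentiable_coe z).hasFDerivAt
  have h2 : M'.logRatio k ∘ h = M.logRatio k := (funext (hR k)).symm
  rw [h2] at h1
  rw [h1.fderiv]
  rfl

theorem preserves_closedAncestors {h : C1Diffeo d}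
    (hR : ∀ k z, M.logRatio k z = M'.logRatio k (h z)) (hdis : M'.DiscrepancyAtEveryNode)
    (j : Fin d) : h.Preserves (↑(G.closedAncestors j) : Set (Fin d)) := by
  have key : ∀ j, ∀ z v : Fin d → ℝ, (∀ r ∈ G.closedAncestors j, v r = 0) →
      fderiv ℝ h z v j = 0 := by
    intro j
    induction j using G.wellFounded_adj.induction with
    | _ j ih =>
      intro z v hv
      obtain ⟨k, hk, hkd⟩ := hdis j
      have hcont : Continuous fun z => fderiv ℝ h z v j :=
        (continuous_apply j).comp
          ((h.contDiff_coe.continuous_fderiv one_ne_zero).clm_apply continuous_const)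
      have hae : (fun z => fderiv ℝ h z v j) =ᵐ[volume] fun _ => (0 : ℝ) := by
        have hgood : ∀ᵐ z : Fin d → ℝ,
            fderiv ℝ (M'.logRatio k) (h z) (Pi.single j 1) ≠ 0 :=
          -- Discrepancy holds for almost every point of the target, but is needed at `h z` for
          -- almost every `z`.
          h.preimage_null (fderiv_logRatio_ne_zero hk hkd)
        filter_upwards [hgood] with z hz
        have h0 : fderiv ℝ (M'.logRatio k) (h z) (fderiv ℝ h z v) = 0 := by
          rw [fderiv_logRatio_comp hR]
          exact (dependsOn_logRatio hk).fderiv_eq_zero (M.differentiable_logRatio k) z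
            fun r hr => hv r (G.closedParents_subset_closedAncestors j hr)
        set w := fderiv ℝ h z v with hw
        -- By induction `w` vanishes at the parents of `j`, so only its `j`-th coordinate
        -- contributes to the derivative of the log ratio.
        have h1 : fderiv ℝ (M'.logRatio k) (h z) (w - w j • Pi.single j 1) = 0 := by
          refine (dependsOn_logRatio hk).fderiv_eq_zero (M'.differentiable_logRatio k) _
            fun r hr => ?_
          by_cases hrj : r = j
          · subst hrj
            simp
          · have hr' : r ∈ G.parents j := Finset.mem_of_mem_insert_of_ne hr hrj
            have : w r = 0 := ih r (G.mem_parents.1 hr') z v fun m hm => hv m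
              (G.closedAncestors_subset (G.parents_subset_closedAncestors j hr') hm)
            simp [this, hrj]
        rw [map_sub, h0, map_smul, zero_sub, neg_eq_zero, smul_eq_mul] at h1
        exact (mul_eq_zero.1 h1).resolve_right hz
      exact congrFun ((hcont.ae_eq_iff_eq volume continuous_const).1 hae) z
  rw [C1Diffeo.preserves_iff_fderiv]
  exact fun z v hv r hr => key r z v fun m hm => hv m (G.closedAncestors_subset hr hm)

theorem preserves_closedParents {h : C1Diffeo d}
    (hR : ∀ k z, M.logRatio k z = M'.logRatio k (h z)) {i : Fin d} (hvar : M'.Variability i) :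
    h.Preserves (↑(G.closedParents i) : Set (Fin d)) := by
  obtain ⟨σ, hσ, hmech, himech, -, hnd⟩ := hvar
  rw [C1Diffeo.preserves_iff_fderiv]
  intro z v hv
  set w := fderiv ℝ h z v with hw
  -- Nondegeneracy is applied to `(a, b)` with `a = 0`, which is trivially symmetric, and `b` the
  -- restriction of `w` to the closed parents.
  have hker : (M'.variabilityMatrix i σ (h z)).mulVec
      (Sum.elim (fun rm => (0 : Matrix (G.closedParents i) (G.closedParents i) ℝ) rm.1 rm.2)
        fun r => w r) = 0 := by
    funext t
    have hk := (hσ t).1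
    have h0 : fderiv ℝ (M'.logRatio (σ t)) (h z) w = 0 := by
      rw [hw, fderiv_logRatio_comp hR]
      exact (dependsOn_logRatio hk).fderiv_eq_zero (M.differentiable_logRatio _) z hv
    have h1 : fderiv ℝ (M'.logRatio (σ t)) (h z)
        (w - ∑ r : G.closedParents i, w r • Pi.single r.1 1) = 0 := by
      refine (dependsOn_logRatio hk).fderiv_eq_zero (M'.differentiable_logRatio _) _
        fun r hr => ?_
      have h2 : ∑ m : G.closedParents i, w m * (Pi.single m.1 1 : Fin d → ℝ) r = w r := by
        rw [Finset.sum_eq_single ⟨r, hr⟩]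
        · simp
        · intro m _ hm
          rw [Pi.single_eq_of_ne (fun h => hm (Subtype.ext h.symm)), mul_zero]
        · simp
      simp only [Pi.sub_apply, Finset.sum_apply, Pi.smul_apply, smul_eq_mul, h2, sub_self]
    rw [map_sub, h0, zero_sub, neg_eq_zero, map_sum] at h1
    simp only [map_smul, smul_eq_mul] at h1
    rw [Pi.zero_apply, ← h1]
    simp only [Matrix.mulVec, dotProduct, Fintype.sum_sum_type, Sum.elim_inl, Sum.elim_inr,
      Matrix.zero_apply, mul_zero, Finset.sum_const_zero, zero_add]
    refine Finset.sum_congr rfl fun r _ => ?_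
    rw [fderiv_logRatio_eq_scoreDiff hk (hmech r r.2) (himech t r r.2), mul_comm]
    rfl
  have hb := (hnd (h z) 0 _ Matrix.isSymm_zero hker).2
  exact fun r hr => congrFun hb ⟨r, hr⟩

end LatentCBN

/-! ### Identifiability -/

theorem mainTheorem8 {d K : ℕ} (G : CausalDAG d) (τ : Fin K → Finset (Fin d)) (i : Fin d)
    (hne : G.parents i ≠ ∅) (hanc : G.parents i ≠ G.ancestors i) :
    IdentifiableUpTo
      (fun M M' : LatentCBN G τ =>
        (M.DiscrepancyAtEveryNode ∨ M'.DiscrepancyAtEveryNode) ∧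
        (M.Variability i ∨ M'.Variability i))
      (parentIndeterminacy G i) := by
  rintro M M' ⟨hdis, hvar⟩ hmap
  let h : C1Diffeo d := M.mix.trans M'.mix.symm
  have hlaw : ∀ k, (M.law k).map h = M'.law k := by
    intro k
    have h1 := congrArg (Measure.map M'.mix.symm) (hmap k)
    rw [Measure.map_map M'.mix.symm.continuous.measurable M.mix.continuous.measurable,
      Measure.map_map M'.mix.symm.continuous.measurable M'.mix.continuous.measurable] at h1
    have h2 : (M'.mix.symm ∘ M'.mix : (Fin d → ℝ) → (Fin d → ℝ)) = id := by
      funext x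
      exact M'.mix.symm_apply_apply x
    rw [h2, Measure.map_id] at h1
    exact h1
  have hR := LatentCBN.logRatio_eq_of_map_eq hlaw
  have hR' : ∀ k z, M'.logRatio k z = M.logRatio k (h.symm z) := by
    intro k z
    rw [hR, h.apply_symm_apply]
  -- If the assumption holds for `M`, the argument applies to `h.symm` with the models exchanged and
  -- is then inverted.
  have hA : ∀ j, h.Preserves (↑(G.closedAncestors j) : Set (Fin d)) := fun j =>
    hdis.elim (fun hd => (LatentCBN.preserves_closedAncestors hR' hd j).symm)
      fun hd => LatentCBN.preserves_closedAncestors hR hd j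
  have hP : h.Preserves (↑(G.closedParents i) : Set (Fin d)) :=
    hvar.elim (fun hv => (LatentCBN.preserves_closedParents hR' hv).symm)
      fun hv => LatentCBN.preserves_closedParents hR hv
  exact ⟨h, ⟨⟨h, rfl⟩, fun j => hA j j (Finset.mem_insert_self _ _), hP⟩, fun z => rfl⟩
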